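/- For a bounded convex domain (nonempty, open, convex set) $\Omega\subset\mathbb{R}^d$, let $0=\mu_0(\Omega)<\mu_1(\Omega)\le\mu_2(\Omega)\le\cdots$ be the eigenvalues, repeated according to multiplicity, of the Neumann problem $-\Delta u=\mu u$ in $\Omega$, $\partial u/\partial\nu=0$ on $\partial\Omega$, in the weak sense: $u\in H^1(\Omega)\setminus\{0\}$ and $\int_\Omega\nabla u\cdot\nabla v\,dx=\mu\int_\Omega uv\,dx$ for all $v\in H^1(\Omega)$. For integers $k,d\ge 1$ put $$\alpha_{k,d}:=\inf\left\{\frac{\mu_k(\Omega_1)}{\mu_k(\Omega_2)}:\ \Omega_1\subset\Omega_2\subset\mathbb{R}^d\ \text{bounded convex domains}\right\}.$$ Then, for all integers $k\ge 1$ and $d\ge 1$, $$\alpha_{k,d}\ \ge\ \alpha_{k,d+1}.$$ -/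

import Mathlib

open MeasureTheory
open scoped ContDiff

namespace NeumannConvex

/-- Euclidean space `ℝ^d`. -/
abbrev E (d : ℕ) : Type := EuclideanSpace ℝ (Fin d)

/-- The Hilbert space `L²(Ω; F)` of (classes of) square integrable `F`-valued functions on `Ω`,
with respect to Lebesgue measure. -/
abbrev L2 {d : ℕ} (Ω : Set (E d)) (F : Type) [NormedAddCommGroup F] : Type :=
  ↥(Lp F 2 ((volume : Measure (E d)).restrict Ω))

/-- `g ∈ L²(Ω; ℝ^d)` is the weak gradient of `u ∈ L²(Ω)`: for each test function
`φ ∈ C_c^∞(Ω)` and each direction `e`, `∫_Ω u ∂_e φ = - ∫_Ω (g · e) φ`.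
Thus `u` lies in the Sobolev space `H¹(Ω)` exactly when such a `g` exists. -/
def HasWeakGradient {d : ℕ} {Ω : Set (E d)} (u : L2 Ω ℝ) (g : L2 Ω (E d)) : Prop :=
  ∀ φ : E d → ℝ, ContDiff ℝ ∞ φ → HasCompactSupport φ → tsupport φ ⊆ Ω →
    ∀ e : E d, ∫ x in Ω, u x * fderiv ℝ φ x e = - ∫ x in Ω, inner ℝ (g x) e * φ x

/-- `u ∈ H¹(Ω)` is a weak solution of the Neumann problem `-Δu = ν u` in `Ω`, `∂u/∂n = 0` on the
boundary: `∫_Ω ∇u · ∇v = ν ∫_Ω u v` for all `v ∈ H¹(Ω)`.  The solution `u = 0` is allowed. -/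
def IsNeumannSolution {d : ℕ} {Ω : Set (E d)} (ν : ℝ) (u : L2 Ω ℝ) : Prop :=
  ∃ g : L2 Ω (E d), HasWeakGradient u g ∧
    ∀ (v : L2 Ω ℝ) (h : L2 Ω (E d)), HasWeakGradient v h →
      ∫ x in Ω, inner ℝ (g x) (h x) = ν * ∫ x in Ω, u x * v x

/-- The linear span, in `L²(Ω)`, of the solutions of the Neumann problem with eigenvalue parameter
in the set `S`.  Since eigenspaces of distinct eigenvalues are orthogonal, its dimension is
the number of Neumann eigenvalues in `S`, counted with multiplicity. -/
noncomputable def neumannSpan {d : ℕ} (Ω : Set (E d)) (S : Set ℝ) : Submodule ℝ (L2 Ω ℝ) :=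
  Submodule.span ℝ {u | ∃ ν ∈ S, IsNeumannSolution ν u}

/-- `μ` is the Neumann eigenvalue `μ_k(Ω)`, where the Neumann eigenvalues
`μ_0(Ω) ≤ μ_1(Ω) ≤ ...` are listed from the index `0` on in increasing order and repeated according
to multiplicity: at most `k` of them are `< μ`, and at least `k + 1` of them are `≤ μ`.
There is at most one such `μ`, it is an eigenvalue, and for a bounded convex domain (where the
embedding of `H¹` in `L²` is compact) it exists for every `k`. -/
def IsNeumannEigenvalue {d : ℕ} (Ω : Set (E d)) (k : ℕ) (μ : ℝ) : Prop :=
  Module.rank ℝ (neumannSpan Ω (Set.Iio μ)) ≤ (k : Cardinal) ∧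
    (k : Cardinal) < Module.rank ℝ (neumannSpan Ω (Set.Iic μ))

/-- Bounded convex domains of `ℝ^d`. -/
structure IsBoundedConvexDomain {d : ℕ} (Ω : Set (E d)) : Prop where
  isOpen : IsOpen Ω
  nonempty : Ω.Nonempty
  bounded : Bornology.IsBounded Ω
  convex : Convex ℝ Ω

/-- The optimal constant `α_{k,d}`: the infimum of `μ_k(Ω₁) / μ_k(Ω₂)` over all pairs `Ω₁ ⊆ Ω₂`
of bounded convex domains of `ℝ^d`.  The infimum of this set of real numbers is taken in the
extended reals, so that it never has a default value. -/
noncomputable def optConst (k d : ℕ) : EReal :=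
  sInf {r : EReal | ∃ (Ω₁ Ω₂ : Set (E d)) (μ₁ μ₂ : ℝ),
    IsBoundedConvexDomain Ω₁ ∧ IsBoundedConvexDomain Ω₂ ∧ Ω₁ ⊆ Ω₂ ∧
    IsNeumannEigenvalue Ω₁ k μ₁ ∧ IsNeumannEigenvalue Ω₂ k μ₂ ∧ r = ((μ₁ / μ₂ : ℝ) : EReal)}

end NeumannConvex

namespace NeumannConvex

/-! Multiplying a domain `Ω` by a short interval `(0, l)` does not change its low Neumann
eigenvalues: any mode that varies along the interval has energy of order `l⁻²`. So a pair `Ω₁ ⊆ Ω₂`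
in dimension `d` yields a pair of cylinders in dimension `d + 1` with the same `μ₁` and `μ₂`. Every
ratio admissible for `d` is thus admissible for `d + 1`, and the infimum can only drop.

No spectral decomposition of the product is needed. Let `T = lift` be composition with the
projection to the base; its adjoint is integration along the vertical fibres, and `T* T = l`. Both
`T` and `T*` carry weak gradients to weak gradients (`hasWeakGradient_lift`,
`hasWeakGradient_adjoint_lift`), so by adjunction both preserve Neumann solutions with the same
parameter.

It remains to see that a solution `w` on the cylinder with `4 l² ν < 1` is a lift. Its vertical part
`v = w - l⁻¹ T T* w` has zero vertical means, and testing the equation with `v` gives `‖∇v‖² = ν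
‖v‖²`. The Poincaré inequality `‖v‖ ≤ 2 l ‖∇v‖` (`norm_le_of_adjoint_lift_eq_zero`) then forces `v =
0`. That inequality is the dual of the Friedrichs inequality for test functions, through the density
of vertical derivatives of test functions among functions with zero vertical means. -/

/-- A linear isometry between the Hilbert product `ℝ^d × ℝ` and `ℝ^(d+1)`. -/
noncomputable def join (d : ℕ) : WithLp 2 (E d × ℝ) ≃ₗᵢ[ℝ] E (d + 1) :=
  ((stdOrthonormalBasis ℝ (WithLp 2 (E d × ℝ))).reindex (finCongr (by
    rw [(WithLp.linearEquiv 2 ℝ (E d × ℝ)).finrank_eq]; simp))).repr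

/-- The horizontal component of a point of `ℝ^(d+1)`. -/
noncomputable def base (d : ℕ) : E (d + 1) →L[ℝ] E d :=
  (WithLp.fstL 2 ℝ (E d) ℝ).comp ((join d).symm.toContinuousLinearEquiv : E (d + 1) →L[ℝ] _)

/-- The vertical component of a point of `ℝ^(d+1)`. -/
noncomputable def height (d : ℕ) : E (d + 1) →L[ℝ] ℝ :=
  (WithLp.sndL 2 ℝ (E d) ℝ).comp ((join d).symm.toContinuousLinearEquiv : E (d + 1) →L[ℝ] _)

/-- The horizontal embedding of `ℝ^d` in `ℝ^(d+1)`. -/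
noncomputable def incl (d : ℕ) : E d →ₗᵢ[ℝ] E (d + 1) where
  toLinearMap := (join d).toLinearEquiv.toLinearMap ∘ₗ
    (WithLp.linearEquiv 2 ℝ (E d × ℝ)).symm.toLinearMap ∘ₗ LinearMap.inl ℝ (E d) ℝ
  norm_map' x := by simp

/-- The vertical unit vector. -/
noncomputable def vert (d : ℕ) : E (d + 1) := join d (WithLp.toLp 2 (0, 1))

/-- The point of `ℝ^(d+1)` with given components. -/
noncomputable def pt (d : ℕ) : E d × ℝ ≃ᵐ E (d + 1) :=
  (MeasurableEquiv.toLp 2 (E d × ℝ)).trans (join d).toMeasurableEquiv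

/-! ### Horizontal and vertical coordinates -/

variable {d : ℕ}

lemma pt_apply (p : E d × ℝ) : pt d p = join d (WithLp.toLp 2 p) := rfl

@[simp] lemma base_pt (p : E d × ℝ) : base d (pt d p) = p.1 := by
  simp [base, pt_apply]

@[simp] lemma height_pt (p : E d × ℝ) : height d (pt d p) = p.2 := by
  simp [height, pt_apply]

lemma pt_base_height (z : E (d + 1)) : pt d (base d z, height d z) = z := by
  obtain ⟨p, rfl⟩ := (pt d).surjective z
  simp

lemma incl_eq_pt (x : E d) : incl d x = pt d (x, 0) := rfl

lemma vert_eq_pt : vert d = pt d (0, 1) := rfl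

@[simp] lemma base_incl (x : E d) : base d (incl d x) = x := by simp [incl_eq_pt]

@[simp] lemma height_incl (x : E d) : height d (incl d x) = 0 := by simp [incl_eq_pt]

@[simp] lemma base_vert : base d (vert d) = 0 := by simp [vert_eq_pt]

@[simp] lemma height_vert : height d (vert d) = 1 := by simp [vert_eq_pt]

lemma pt_eq_add (x : E d) (t : ℝ) : pt d (x, t) = incl d x + t • vert d := by
  rw [incl_eq_pt, vert_eq_pt, pt_apply, pt_apply, pt_apply, ← map_smul, ← map_add,
    ← WithLp.toLp_smul, ← WithLp.toLp_add]
  simp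

lemma eq_incl_add_vert (z : E (d + 1)) : z = incl d (base d z) + height d z • vert d := by
  rw [← pt_eq_add, pt_base_height]

lemma inner_incl_left (x : E d) (z : E (d + 1)) : inner ℝ (incl d x) z = inner ℝ x (base d z) := by
  obtain ⟨p, rfl⟩ := (pt d).surjective z
  rw [base_pt, incl_eq_pt, pt_apply, pt_apply, LinearIsometryEquiv.inner_map_map]
  simp [WithLp.prod_inner_apply]

lemma norm_vert : ‖vert d‖ = 1 := by
  simp [vert]

lemma continuous_pt : Continuous (pt d) :=
  (join d).continuous.comp (WithLp.prod_continuous_toLp 2 _ _)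

lemma measurePreserving_pt :
    MeasurePreserving (pt d) ((volume : Measure (E d)).prod (volume : Measure ℝ)) volume :=
  (LinearIsometryEquiv.measurePreserving (join d)).comp (WithLp.volume_preserving_toLp (E d) ℝ)

/-! ### Cylinders and Fubini on them -/

/-- The cylinder of height `l` over `Ω`. -/
def cyl (Ω : Set (E d)) (l : ℝ) : Set (E (d + 1)) :=
  base d ⁻¹' Ω ∩ height d ⁻¹' Set.Ioo 0 l

lemma cyl_mono {Ω₁ Ω₂ : Set (E d)} (h : Ω₁ ⊆ Ω₂) (l : ℝ) : cyl Ω₁ l ⊆ cyl Ω₂ l :=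
  Set.inter_subset_inter_left _ (Set.preimage_mono h)

lemma pt_preimage_cyl (Ω : Set (E d)) (l : ℝ) : pt d ⁻¹' cyl Ω l = Ω ×ˢ Set.Ioo 0 l := by
  ext p
  simp [cyl]

lemma isBoundedConvexDomain_cyl {Ω : Set (E d)} (h : IsBoundedConvexDomain Ω) {l : ℝ}
    (hl : 0 < l) : IsBoundedConvexDomain (cyl Ω l) where
  isOpen := (h.isOpen.preimage (base d).continuous).inter
    (isOpen_Ioo.preimage (height d).continuous)
  nonempty := by
    obtain ⟨x, hx⟩ := h.nonempty
    exact ⟨pt d (x, l / 2), by simp [cyl, hx, hl]⟩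
  bounded := by
    obtain ⟨R, hR⟩ := h.bounded.exists_norm_le
    refine isBounded_iff_forall_norm_le.2 ⟨R + l, fun z hz => ?_⟩
    rw [eq_incl_add_vert z]
    refine (norm_add_le _ _).trans (add_le_add ?_ ?_)
    · rw [LinearIsometry.norm_map]
      exact hR _ hz.1
    · rw [norm_smul, norm_vert, mul_one, Real.norm_eq_abs, abs_of_pos hz.2.1]
      exact hz.2.2.le
  convex := (h.convex.linear_preimage (base d).toLinearMap).inter
    ((convex_Ioo 0 l).linear_preimage (height d).toLinearMap)

lemma measurePreserving_pt_cyl (Ω : Set (E d)) (l : ℝ) :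
    MeasurePreserving (pt d)
      (((volume : Measure (E d)).restrict Ω).prod ((volume : Measure ℝ).restrict (Set.Ioo 0 l)))
      (volume.restrict (cyl Ω l)) := by
  rw [Measure.prod_restrict, ← pt_preimage_cyl]
  exact measurePreserving_pt.restrict_preimage_emb (pt d).measurableEmbedding _

lemma integral_cyl (Ω : Set (E d)) (l : ℝ) {f : E (d + 1) → ℝ} :
    ∫ z in cyl Ω l, f z = ∫ p, f (pt d p) ∂((volume : Measure (E d)).restrict Ω).prod
      ((volume : Measure ℝ).restrict (Set.Ioo 0 l)) :=
  ((measurePreserving_pt_cyl Ω l).integral_comp (pt d).measurableEmbedding f).symm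

lemma integrableOn_cyl_iff (Ω : Set (E d)) (l : ℝ) {f : E (d + 1) → ℝ} :
    IntegrableOn f (cyl Ω l) ↔ Integrable (fun p => f (pt d p))
      (((volume : Measure (E d)).restrict Ω).prod
        ((volume : Measure ℝ).restrict (Set.Ioo 0 l))) :=
  ((measurePreserving_pt_cyl Ω l).integrable_comp_emb (pt d).measurableEmbedding).symm

lemma map_base_cyl (Ω : Set (E d)) (l : ℝ) :
    Measure.map (base d) (volume.restrict (cyl Ω l)) =
      ENNReal.ofReal l • (volume : Measure (E d)).restrict Ω := by
  rw [← (measurePreserving_pt_cyl Ω l).map_eq,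
    Measure.map_map (base d).continuous.measurable (pt d).measurable]
  have : base d ∘ pt d = Prod.fst := by
    ext1 p
    simp
  rw [this]
  simp

/-! ### Test functions -/

/-- Smooth functions with compact support contained in `U`. -/
structure IsTest {V : Type*} [NormedAddCommGroup V] [NormedSpace ℝ V] (U : Set V)
    (φ : V → ℝ) : Prop where
  contDiff : ContDiff ℝ ∞ φ
  compact : HasCompactSupport φ
  subset : tsupport φ ⊆ U

section Test

variable {V : Type*} [NormedAddCommGroup V] [NormedSpace ℝ V] {U : Set V} {φ ψ : V → ℝ}

lemma IsTest.of_support_subset (h : ContDiff ℝ ∞ φ) {K : Set V} (hK : IsCompact K)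
    (hφ : Function.support φ ⊆ K) (hU : K ⊆ U) : IsTest U φ where
  contDiff := h
  compact := HasCompactSupport.of_support_subset_isCompact hK hφ
  subset := (closure_minimal hφ hK.isClosed).trans hU

lemma IsTest.continuous (h : IsTest U φ) : Continuous φ := h.contDiff.continuous

lemma IsTest.differentiable (h : IsTest U φ) : Differentiable ℝ φ :=
  h.contDiff.differentiable (by simp)

lemma IsTest.eq_zero (h : IsTest U φ) {x : V} (hx : x ∉ U) : φ x = 0 :=
  image_eq_zero_of_notMem_tsupport fun h' => hx (h.subset h')

lemma IsTest.fderiv_apply (h : IsTest U φ) (e : V) : IsTest U (fun x => fderiv ℝ φ x e) where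
  contDiff := (h.contDiff.fderiv_right (m := ∞) (by simp)).clm_apply contDiff_const
  compact := h.compact.fderiv_apply (𝕜 := ℝ) e
  subset := (tsupport_fderiv_apply_subset ℝ e).trans h.subset

lemma IsTest.add (h : IsTest U φ) (h' : IsTest U ψ) : IsTest U (φ + ψ) where
  contDiff := h.contDiff.add h'.contDiff
  compact := h.compact.add h'.compact
  subset := (tsupport_add φ ψ).trans (Set.union_subset h.subset h'.subset)

lemma IsTest.const_smul (h : IsTest U φ) (c : ℝ) : IsTest U (c • φ) where
  contDiff := h.contDiff.const_smul c
  compact := h.compact.mono (Function.support_const_smul_subset c φ)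
  subset := (closure_mono (Function.support_const_smul_subset c φ)).trans h.subset

lemma isTest_zero : IsTest U (0 : V → ℝ) where
  contDiff := contDiff_const
  compact := HasCompactSupport.zero
  subset := by simp [tsupport]

variable [MeasurableSpace V] [BorelSpace V]
  {F : Type*} [NormedAddCommGroup F] [NormedSpace ℝ F]

lemma IsTest.memLp (h : IsTest U φ) (μ : Measure V) [IsFiniteMeasureOnCompacts μ] :
    MemLp φ 2 μ :=
  h.continuous.memLp_of_hasCompactSupport h.compact

lemma IsTest.memLp_smul (h : IsTest U φ) (e : F) (μ : Measure V) [IsFiniteMeasureOnCompacts μ] :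
    MemLp (fun x => φ x • e) 2 μ :=
  (h.continuous.smul continuous_const).memLp_of_hasCompactSupport h.compact.smul_right

end Test

lemma IsTest.mul_base_height {Ω : Set (E d)} {l : ℝ} {φ : E d → ℝ} {ρ : ℝ → ℝ} (hφ : IsTest Ω φ)
    (hρ : IsTest (Set.Ioo 0 l) ρ) :
    IsTest (cyl Ω l) (fun z => φ (base d z) * ρ (height d z)) := by
  refine IsTest.of_support_subset
    ((hφ.contDiff.comp (base d).contDiff).mul (hρ.contDiff.comp (height d).contDiff))
    ((hφ.compact.prod hρ.compact).image continuous_pt) ?_ ?_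
  · intro z hz
    rw [Function.mem_support, mul_ne_zero_iff] at hz
    exact ⟨(base d z, height d z), ⟨subset_closure hz.1, subset_closure hz.2⟩, pt_base_height z⟩
  · rintro _ ⟨p, hp, rfl⟩
    exact ⟨by simpa using hφ.subset hp.1, by simpa using hρ.subset hp.2⟩

lemma fderiv_mul_base_height {φ : E d → ℝ} {ρ : ℝ → ℝ} (hφ : Differentiable ℝ φ)
    (hρ : Differentiable ℝ ρ) (z e : E (d + 1)) :
    fderiv ℝ (fun z => φ (base d z) * ρ (height d z)) z e =
      fderiv ℝ φ (base d z) (base d e) * ρ (height d z) +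
        φ (base d z) * (deriv ρ (height d z) * height d e) := by
  have h1 : HasFDerivAt (fun z => φ (base d z)) ((fderiv ℝ φ (base d z)).comp (base d)) z :=
    (hφ _).hasFDerivAt.comp z (base d).hasFDerivAt
  have h2 : HasFDerivAt (fun z => ρ (height d z)) (deriv ρ (height d z) • height d) z :=
    (hρ _).hasDerivAt.comp_hasFDerivAt z (height d).hasFDerivAt
  have h3 : HasFDerivAt (fun z => φ (base d z) * ρ (height d z)) _ z := h1.mul h2
  rw [h3.fderiv]
  simp
  ring

lemma IsTest.slice {Ω : Set (E d)} {l : ℝ} {φ : E (d + 1) → ℝ} (hφ : IsTest (cyl Ω l) φ) (t : ℝ) :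
    IsTest Ω (fun x => φ (pt d (x, t))) := by
  have hc : ContDiff ℝ ∞ (fun x => pt d (x, t)) := by
    simp_rw [pt_eq_add]
    exact (incl d).contDiff.add contDiff_const
  refine IsTest.of_support_subset (hφ.contDiff.comp hc)
    (hφ.compact.isCompact.image (base d).continuous) ?_ ?_
  · intro x hx
    exact ⟨pt d (x, t), subset_closure hx, by simp⟩
  · rintro _ ⟨z, hz, rfl⟩
    exact (hφ.subset hz).1

lemma fderiv_slice {φ : E (d + 1) → ℝ} (hφ : Differentiable ℝ φ) (x e : E d) (t : ℝ) :
    fderiv ℝ (fun x => φ (pt d (x, t))) x e = fderiv ℝ φ (pt d (x, t)) (incl d e) := by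
  have h1 : HasFDerivAt (fun x => pt d (x, t)) (incl d).toContinuousLinearMap x := by
    simp_rw [pt_eq_add]
    exact (incl d).toContinuousLinearMap.hasFDerivAt.add_const _
  have := (hφ (pt d (x, t))).hasFDerivAt.comp x h1
  rw [show (fun x => φ (pt d (x, t))) = φ ∘ (fun x => pt d (x, t)) from rfl, this.fderiv]
  rfl

/-- Fundamental theorem of calculus on a vertical line, along which `φ` has compact support. -/
lemma integral_fderiv_vert {Ω : Set (E d)} {l : ℝ} {φ : E (d + 1) → ℝ}
    (hφ : IsTest (cyl Ω l) φ) (x : E d) :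
    ∫ t in Set.Ioo 0 l, fderiv ℝ φ (pt d (x, t)) (vert d) = 0 := by
  have hd (t : ℝ) : HasDerivAt (fun t => φ (pt d (x, t)))
      (fderiv ℝ φ (pt d (x, t)) (vert d)) t := by
    have h1 : HasDerivAt (fun t => pt d (x, t)) (vert d) t := by
      simp_rw [pt_eq_add]
      simpa using ((hasDerivAt_id t).smul_const (vert d)).const_add (incl d x)
    exact (hφ.differentiable _).hasFDerivAt.comp_hasDerivAt t h1
  have hc : HasCompactSupport (fun t => φ (pt d (x, t))) := by
    refine HasCompactSupport.of_support_subset_isCompact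
      (hφ.compact.isCompact.image (height d).continuous) ?_
    intro t ht
    exact ⟨pt d (x, t), subset_closure ht, by simp⟩
  have hcont : Continuous fun t => fderiv ℝ φ (pt d (x, t)) (vert d) :=
    (hφ.fderiv_apply (vert d)).continuous.comp (continuous_pt.comp (by fun_prop))
  have hder : deriv (fun t => φ (pt d (x, t))) = fun t => fderiv ℝ φ (pt d (x, t)) (vert d) :=
    funext fun t => (hd t).deriv
  rw [setIntegral_eq_integral_of_forall_compl_eq_zero]
  · have hi : Integrable (fun t => fderiv ℝ φ (pt d (x, t)) (vert d)) :=
      hcont.integrable_of_hasCompactSupport (hder ▸ hc.deriv)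
    have h0 : Integrable (fun t => φ (pt d (x, t))) :=
      (hφ.continuous.comp (continuous_pt.comp (by fun_prop))).integrable_of_hasCompactSupport hc
    exact integral_eq_zero_of_hasDerivAt_of_integrable hd hi h0
  · intro t ht
    refine (hφ.fderiv_apply (vert d)).eq_zero fun h => ht ?_
    simpa using h.2

/-! ### Lifting to the cylinder -/

section Lift

variable {Ω : Set (E d)} {l : ℝ} {F G : Type} [NormedAddCommGroup F] [InnerProductSpace ℝ F]
  [NormedAddCommGroup G] [InnerProductSpace ℝ G]

lemma quasiMeasurePreserving_base (Ω : Set (E d)) (l : ℝ) :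
    Measure.QuasiMeasurePreserving (base d) (volume.restrict (cyl Ω l)) (volume.restrict Ω) where
  measurable := (base d).continuous.measurable
  absolutelyContinuous := by
    rw [map_base_cyl]
    exact Measure.smul_absolutelyContinuous

lemma memLp_comp_base {u : E d → F} (hu : MemLp u 2 (volume.restrict Ω)) (l : ℝ)
    (L : F →ₗᵢ[ℝ] G) : MemLp (fun z => L (u (base d z))) 2 (volume.restrict (cyl Ω l)) := by
  refine L.toContinuousLinearMap.comp_memLp' (f := fun z => u (base d z)) ?_
  refine MemLp.comp_of_map (g := u) ?_ (base d).continuous.aemeasurable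
  rw [map_base_cyl]
  exact hu.smul_measure ENNReal.ofReal_ne_top

/-- The function `z ↦ L (u (base z))`, as a linear map in `u`. -/
noncomputable def liftₗ (Ω : Set (E d)) (l : ℝ) (L : F →ₗᵢ[ℝ] G) :
    L2 Ω F →ₗ[ℝ] L2 (cyl Ω l) G where
  toFun u := (memLp_comp_base (Lp.memLp u) l L).toLp
  map_add' u v := by
    rw [← MemLp.toLp_add]
    refine MemLp.toLp_congr _ _ ?_
    filter_upwards [(quasiMeasurePreserving_base Ω l).ae (Lp.coeFn_add u v)] with z hz
    exact (congrArg L hz).trans (map_add L _ _)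
  map_smul' c u := by
    rw [RingHom.id_apply, ← MemLp.toLp_const_smul]
    refine MemLp.toLp_congr _ _ ?_
    filter_upwards [(quasiMeasurePreserving_base Ω l).ae (Lp.coeFn_smul c u)] with z hz
    exact (congrArg L hz).trans (map_smul L _ _)

lemma coeFn_liftₗ (L : F →ₗᵢ[ℝ] G) (u : L2 Ω F) :
    liftₗ Ω l L u =ᵐ[volume.restrict (cyl Ω l)] fun z => L (u (base d z)) :=
  MemLp.coeFn_toLp (memLp_comp_base (Lp.memLp u) l L)

/-- Every vertical fibre has length `max l 0`; for `l ≤ 0` the cylinder is empty and both sides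
vanish. -/
lemma inner_liftₗ (L : F →ₗᵢ[ℝ] G) (u v : L2 Ω F) :
    inner ℝ (liftₗ Ω l L u) (liftₗ Ω l L v) = max l 0 * inner ℝ u v := by
  rw [L2.inner_def, L2.inner_def]
  have : ∫ z in cyl Ω l, inner ℝ (liftₗ Ω l L u z) (liftₗ Ω l L v z) =
      ∫ z in cyl Ω l, inner ℝ (u (base d z)) (v (base d z)) := by
    refine integral_congr_ae ?_
    filter_upwards [coeFn_liftₗ L u, coeFn_liftₗ L v] with z h1 h2
    rw [h1, h2, LinearIsometry.inner_map_map]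
  rw [this, ← integral_map (φ := base d) (f := fun x => inner ℝ (u x) (v x))
    (base d).continuous.aemeasurable, map_base_cyl, integral_smul_measure,
    ENNReal.toReal_ofReal', smul_eq_mul]
  rw [map_base_cyl]
  exact (L2.integrable_inner (𝕜 := ℝ) u v).aestronglyMeasurable.mono_ac
    Measure.smul_absolutelyContinuous

/-- The function `z ↦ L (u (base z))`, as a continuous linear map in `u`. -/
noncomputable def lift (Ω : Set (E d)) (l : ℝ) (L : F →ₗᵢ[ℝ] G) :
    L2 Ω F →L[ℝ] L2 (cyl Ω l) G :=
  (liftₗ Ω l L).mkContinuous √(max l 0) fun u => by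
    have h := inner_liftₗ (l := l) L u u
    rw [real_inner_self_eq_norm_sq, real_inner_self_eq_norm_sq] at h
    refine le_of_sq_le_sq ?_ (by positivity)
    rw [mul_pow, Real.sq_sqrt (le_max_right _ _), h]

lemma coeFn_lift (L : F →ₗᵢ[ℝ] G) (u : L2 Ω F) :
    lift Ω l L u =ᵐ[volume.restrict (cyl Ω l)] fun z => L (u (base d z)) :=
  coeFn_liftₗ L u

lemma inner_lift (hl : 0 ≤ l) (L : F →ₗᵢ[ℝ] G) (u v : L2 Ω F) :
    inner ℝ (lift Ω l L u) (lift Ω l L v) = l * inner ℝ u v :=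
  (inner_liftₗ L u v).trans (by rw [max_eq_left hl])

/-- Consequently, for `l > 0`, `l⁻¹ T T*` is the orthogonal projection onto the lifted functions,
that is, averaging in the vertical direction. -/
lemma adjoint_lift_lift [CompleteSpace F] [CompleteSpace G] (hl : 0 ≤ l) (L : F →ₗᵢ[ℝ] G)
    (u : L2 Ω F) : (lift Ω l L).adjoint (lift Ω l L u) = l • u := by
  refine ext_inner_right ℝ fun v => ?_
  rw [ContinuousLinearMap.adjoint_inner_left, inner_lift hl, real_inner_smul_left]

lemma lift_injective (hl : 0 < l) (L : F →ₗᵢ[ℝ] G) : Function.Injective (lift Ω l L) := by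
  rw [injective_iff_map_eq_zero]
  intro u hu
  have h := inner_lift hl.le L u u
  rw [hu, inner_zero_left] at h
  exact inner_self_eq_zero.1 ((mul_eq_zero.1 h.symm).resolve_left hl.ne')

end Lift

/-! ### Integrals as `L²` inner products, and the fundamental lemma -/

lemma integral_inner_eq_inner_toLp {X F : Type*} [MeasurableSpace X] {μ : Measure X}
    [NormedAddCommGroup F] [InnerProductSpace ℝ F] (v : Lp F 2 μ) {f : X → F}
    (hf : MemLp f 2 μ) : ∫ x, inner ℝ (v x) (f x) ∂μ = inner ℝ v hf.toLp := by
  rw [L2.inner_def]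
  refine integral_congr_ae ?_
  filter_upwards [hf.coeFn_toLp] with x hx
  rw [hx]

lemma integral_mul_eq_inner_toLp {X : Type*} [MeasurableSpace X] {μ : Measure X} (v : Lp ℝ 2 μ)
    {f : X → ℝ} (hf : MemLp f 2 μ) : ∫ x, v x * f x ∂μ = inner ℝ v hf.toLp := by
  rw [← integral_inner_eq_inner_toLp]
  simp [mul_comm]

lemma integral_mul_eq_inner {X : Type*} [MeasurableSpace X] {μ : Measure X} (u v : Lp ℝ 2 μ) :
    ∫ x, u x * v x ∂μ = inner ℝ u v := by
  rw [L2.inner_def]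
  simp [mul_comm]

lemma ae_eq_zero_of_forall_isTest {V : Type*} [NormedAddCommGroup V] [NormedSpace ℝ V]
    [FiniteDimensional ℝ V] [MeasurableSpace V] [BorelSpace V] {μ : Measure V} {U : Set V}
    (hU : IsOpen U) {f : V → ℝ} (hf : IntegrableOn f U μ)
    (h : ∀ φ, IsTest U φ → ∫ x in U, φ x * f x ∂μ = 0) : f =ᵐ[μ.restrict U] 0 := by
  rw [Filter.EventuallyEq, ae_restrict_iff' hU.measurableSet]
  refine hU.ae_eq_zero_of_integral_contDiff_smul_eq_zero hf.locallyIntegrableOn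
    fun φ h1 h2 h3 => ?_
  have hφ : IsTest U φ := ⟨h1, h2, h3⟩
  rw [← h φ hφ, setIntegral_eq_integral_of_forall_compl_eq_zero]
  · rfl
  · intro x hx
    rw [hφ.eq_zero hx, zero_mul]

/-! ### Weak gradients under lifting and vertical integration -/

section Weak

variable {Ω : Set (E d)} {l : ℝ}

/-- Split `e` into horizontal and vertical components. The vertical one contributes nothing, by
`integral_fderiv_vert`; for the horizontal one, the hypothesis applies to the slice of `φ` at each
height. -/
lemma hasWeakGradient_lift {u : L2 Ω ℝ} {g : L2 Ω (E d)} (h : HasWeakGradient u g) (l : ℝ) :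
    HasWeakGradient (lift Ω l .id u) (lift Ω l (incl d) g) := by
  intro φ h1 h2 h3 e
  have hφ : IsTest (cyl Ω l) φ := ⟨h1, h2, h3⟩
  have hu : MemLp (fun z => u (base d z)) 2 (volume.restrict (cyl Ω l)) :=
    memLp_comp_base (Lp.memLp u) l .id
  have hg : MemLp (fun z => inner ℝ (g (base d z)) (base d e)) 2 (volume.restrict (cyl Ω l)) :=
    (memLp_comp_base (Lp.memLp g) l .id).inner_const _
  have hint (w : E (d + 1)) :
      IntegrableOn (fun z => u (base d z) * fderiv ℝ φ z w) (cyl Ω l) :=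
    hu.integrable_mul ((hφ.fderiv_apply w).memLp _)
  have hint' : IntegrableOn (fun z => inner ℝ (g (base d z)) (base d e) * φ z) (cyl Ω l) :=
    hg.integrable_mul (hφ.memLp _)
  have hL : ∫ z in cyl Ω l, lift Ω l .id u z * fderiv ℝ φ z e =
      ∫ z in cyl Ω l, (u (base d z) * fderiv ℝ φ z (incl d (base d e)) +
        height d e * (u (base d z) * fderiv ℝ φ z (vert d))) := by
    refine integral_congr_ae ?_
    filter_upwards [coeFn_lift (l := l) .id u] with z hz
    rw [hz]
    conv_lhs => rw [eq_incl_add_vert e, map_add, map_smul]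
    simp
    ring
  have hR : ∫ z in cyl Ω l, inner ℝ (lift Ω l (incl d) g z) e * φ z =
      ∫ z in cyl Ω l, inner ℝ (g (base d z)) (base d e) * φ z := by
    refine integral_congr_ae ?_
    filter_upwards [coeFn_lift (l := l) (incl d) g] with z hz
    rw [hz, inner_incl_left]
  have hv : ∫ z in cyl Ω l, u (base d z) * fderiv ℝ φ z (vert d) = 0 := by
    rw [integral_cyl, integral_prod _ ((integrableOn_cyl_iff Ω l).1 (hint (vert d)))]
    simp [integral_const_mul, integral_fderiv_vert hφ]
  rw [hL, hR, integral_add (hint _) ((hint _).const_mul _), integral_const_mul, hv, mul_zero,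
    add_zero, integral_cyl, integral_cyl,
    integral_prod_symm _ ((integrableOn_cyl_iff Ω l).1 (hint _)),
    integral_prod_symm _ ((integrableOn_cyl_iff Ω l).1 hint'), ← integral_neg]
  refine integral_congr_ae (Filter.Eventually.of_forall fun t => ?_)
  have hs := hφ.slice t
  have := h _ hs.contDiff hs.compact hs.subset (base d e)
  simp_rw [fderiv_slice hφ.differentiable] at this
  simpa using this

lemma integral_height_mul {F : E (d + 1) → ℝ} {c : ℝ → ℝ}
    (h : IntegrableOn (fun z => c (height d z) * F z) (cyl Ω l)) :
    ∫ z in cyl Ω l, c (height d z) * F z =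
      ∫ t in Set.Ioo 0 l, c t * ∫ x in Ω, F (pt d (x, t)) := by
  rw [integral_cyl, integral_prod_symm _ ((integrableOn_cyl_iff Ω l).1 h)]
  simp [integral_const_mul]

lemma integrableOn_height_mul {F : E (d + 1) → ℝ} {c : ℝ → ℝ} (hF : IntegrableOn F (cyl Ω l))
    (hc : Measurable c) {C : ℝ} (hC : ∀ t, |c t| ≤ C) :
    IntegrableOn (fun z => c (height d z) * F z) (cyl Ω l) :=
  Integrable.bdd_mul hF (hc.comp (height d).continuous.measurable).aestronglyMeasurable
    (Filter.Eventually.of_forall fun _ => hC _)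

lemma IsTest.integrableOn_height_mul {F : E (d + 1) → ℝ} {ρ : ℝ → ℝ}
    (hF : IntegrableOn F (cyl Ω l)) {U : Set ℝ} (hρ : IsTest U ρ) :
    IntegrableOn (fun z => ρ (height d z) * F z) (cyl Ω l) := by
  obtain ⟨C, hC⟩ := hρ.compact.exists_bound_of_continuous hρ.continuous
  exact NeumannConvex.integrableOn_height_mul hF hρ.continuous.measurable hC

lemma integrableOn_integral_slice {F : E (d + 1) → ℝ} (hF : IntegrableOn F (cyl Ω l)) :
    IntegrableOn (fun t => ∫ x in Ω, F (pt d (x, t))) (Set.Ioo 0 l) :=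
  ((integrableOn_cyl_iff Ω l).1 hF).integral_prod_right

lemma integral_cyl_eq_integral_slice {F : E (d + 1) → ℝ} (hF : IntegrableOn F (cyl Ω l)) :
    ∫ z in cyl Ω l, F z = ∫ t in Set.Ioo 0 l, ∫ x in Ω, F (pt d (x, t)) := by
  rw [integral_cyl, integral_prod_symm _ ((integrableOn_cyl_iff Ω l).1 hF)]

/-- Allows a vertical cutoff `ρ` to be inserted and then removed: if all cutoff integrals vanish,
the slice integral is zero at almost every height. -/
lemma integral_cyl_eq_zero {F : E (d + 1) → ℝ} (hF : IntegrableOn F (cyl Ω l))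
    (h : ∀ ρ, IsTest (Set.Ioo 0 l) ρ → ∫ z in cyl Ω l, ρ (height d z) * F z = 0) :
    ∫ z in cyl Ω l, F z = 0 := by
  rw [integral_cyl_eq_integral_slice hF]
  have := ae_eq_zero_of_forall_isTest isOpen_Ioo (integrableOn_integral_slice hF)
    fun ρ hρ => (integral_height_mul (hρ.integrableOn_height_mul hF)).symm.trans (h ρ hρ)
  rw [integral_congr_ae this]
  simp

lemma integral_adjoint_lift_mul (v : L2 (cyl Ω l) ℝ) {ψ : E d → ℝ} (hψ : IsTest Ω ψ) :
    ∫ x in Ω, (lift Ω l .id).adjoint v x * ψ x = ∫ z in cyl Ω l, v z * ψ (base d z) := by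
  rw [integral_mul_eq_inner_toLp _ (hψ.memLp _), ContinuousLinearMap.adjoint_inner_left,
    ← integral_mul_eq_inner]
  refine integral_congr_ae ?_
  filter_upwards [coeFn_lift (l := l) .id ((hψ.memLp (volume.restrict Ω)).toLp),
    (quasiMeasurePreserving_base Ω l).ae (hψ.memLp (volume.restrict Ω)).coeFn_toLp] with z h1 h2
  rw [h1, h2]
  rfl

lemma integral_inner_adjoint_lift_mul (h : L2 (cyl Ω l) (E (d + 1))) {ψ : E d → ℝ}
    (hψ : IsTest Ω ψ) (e : E d) :
    ∫ x in Ω, inner ℝ ((lift Ω l (incl d)).adjoint h x) e * ψ x =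
      ∫ z in cyl Ω l, inner ℝ (h z) (incl d e) * ψ (base d z) := by
  have hm := hψ.memLp_smul e (volume.restrict Ω)
  have : ∫ x in Ω, inner ℝ ((lift Ω l (incl d)).adjoint h x) e * ψ x =
      ∫ x in Ω, inner ℝ ((lift Ω l (incl d)).adjoint h x) (ψ x • e) := by
    simp [real_inner_smul_right, mul_comm]
  rw [this, integral_inner_eq_inner_toLp _ hm, ContinuousLinearMap.adjoint_inner_left,
    L2.inner_def]
  refine integral_congr_ae ?_
  filter_upwards [coeFn_lift (l := l) (incl d) hm.toLp,
    (quasiMeasurePreserving_base Ω l).ae hm.coeFn_toLp] with z h1 h2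
  rw [h1, h2, map_smul, real_inner_smul_right, mul_comm]

/-- The function `φ ∘ base` is not compactly supported in the cylinder, so it is first multiplied by
a cutoff in the height. A horizontal derivative does not see the cutoff, which
`integral_cyl_eq_zero` then removes. -/
lemma hasWeakGradient_adjoint_lift {v : L2 (cyl Ω l) ℝ} {h : L2 (cyl Ω l) (E (d + 1))}
    (hv : HasWeakGradient v h) :
    HasWeakGradient ((lift Ω l .id).adjoint v) ((lift Ω l (incl d)).adjoint h) := by
  intro φ h1 h2 h3 e
  have hφ : IsTest Ω φ := ⟨h1, h2, h3⟩
  rw [integral_adjoint_lift_mul v (hφ.fderiv_apply e), integral_inner_adjoint_lift_mul h hφ e]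
  have i1 : IntegrableOn (fun z => v z * fderiv ℝ φ (base d z) e) (cyl Ω l) :=
    (Lp.memLp v).integrable_mul (memLp_comp_base ((hφ.fderiv_apply e).memLp _) l .id)
  have i2 : IntegrableOn (fun z => inner ℝ (h z) (incl d e) * φ (base d z)) (cyl Ω l) :=
    ((Lp.memLp h).inner_const _).integrable_mul (memLp_comp_base (hφ.memLp _) l .id)
  rw [← add_eq_zero_iff_eq_neg, ← integral_add i1 i2]
  refine integral_cyl_eq_zero (i1.add i2) fun ρ hρ => ?_
  have ht := hφ.mul_base_height hρ
  have := hv _ ht.contDiff ht.compact ht.subset (incl d e)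
  simp_rw [fderiv_mul_base_height hφ.differentiable hρ.differentiable, base_incl, height_incl,
    mul_zero, add_zero] at this
  simp_rw [mul_add]
  rw [integral_add (hρ.integrableOn_height_mul i1) (hρ.integrableOn_height_mul i2),
    add_eq_zero_iff_eq_neg]
  calc _ = ∫ z in cyl Ω l, v z * (fderiv ℝ φ (base d z) e * ρ (height d z)) := by
        congr 1; ext z; ring
    _ = _ := this
    _ = _ := by congr 2; ext z; ring

end Weak

/-! ### One-dimensional primitives and the du Bois-Reymond lemma -/

lemma IsTest.setIntegral_eq {V : Type*} [NormedAddCommGroup V] [NormedSpace ℝ V]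
    [MeasurableSpace V] {μ : Measure V} {U : Set V} {φ : V → ℝ} (h : IsTest U φ) :
    ∫ x in U, φ x ∂μ = ∫ x, φ x ∂μ :=
  setIntegral_eq_integral_of_forall_compl_eq_zero fun _ => h.eq_zero

lemma exists_isTest_integral_eq_one {l : ℝ} (hl : 0 < l) :
    ∃ ρ : ℝ → ℝ, IsTest (Set.Ioo 0 l) ρ ∧ ∫ t in Set.Ioo 0 l, ρ t = 1 := by
  let f : ContDiffBump (l / 2) := ⟨l / 8, l / 4, by positivity, by linarith⟩
  have hf : IsTest (Set.Ioo 0 l) (f.normed volume) := by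
    refine ⟨f.contDiff_normed, f.hasCompactSupport_normed, ?_⟩
    rw [f.tsupport_normed_eq, Real.closedBall_eq_Icc]
    rintro x ⟨h1, h2⟩
    simp only [f] at h1 h2
    exact ⟨by linarith, by linarith⟩
  exact ⟨_, hf, hf.setIntegral_eq.trans f.integral_normed⟩

lemma exists_subset_Icc {K : Set ℝ} (hK : IsCompact K) {l : ℝ} (h : K ⊆ Set.Ioo 0 l) :
    ∃ a b, K ⊆ Set.Icc a b ∧ Set.Icc a b ⊆ Set.Ioo 0 l := by
  rcases K.eq_empty_or_nonempty with rfl | hne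
  · exact ⟨1, 0, by simp, by simp⟩
  · have h1 := h (hK.sInf_mem hne)
    have h2 := h (hK.sSup_mem hne)
    exact ⟨sInf K, sSup K, fun x hx => ⟨csInf_le hK.bddBelow hx, le_csSup hK.bddAbove hx⟩,
      fun x hx => ⟨h1.1.trans_le hx.1, hx.2.trans_lt h2.2⟩⟩

/-- The primitive vanishes to the left of the support of `b`, and to its right because the total
integral is zero. -/
lemma IsTest.exists_deriv_eq {l : ℝ} {b : ℝ → ℝ} (hb : IsTest (Set.Ioo 0 l) b)
    (h0 : ∫ t in Set.Ioo 0 l, b t = 0) : ∃ B, IsTest (Set.Ioo 0 l) B ∧ deriv B = b := by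
  obtain ⟨α, β, hK, hI⟩ := exists_subset_Icc hb.compact.isCompact hb.subset
  rw [hb.setIntegral_eq] at h0
  have hint : Integrable b := hb.continuous.integrable_of_hasCompactSupport hb.compact
  have hzero (t : ℝ) (ht : t ∉ Set.Icc α β) : b t = 0 :=
    image_eq_zero_of_notMem_tsupport fun h => ht (hK h)
  have hder : deriv (fun t => ∫ s in (0 : ℝ)..t, b s) = b :=
    funext fun t => hb.continuous.deriv_integral b 0 t
  have hB (t : ℝ) : ∫ s in (0 : ℝ)..t, b s = ∫ s in Set.Iic t, b s := by
    rw [← intervalIntegral.integral_Iic_sub_Iic hint.integrableOn hint.integrableOn,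
      setIntegral_eq_zero_of_forall_eq_zero (t := Set.Iic (0 : ℝ)), sub_zero]
    intro s hs
    exact hb.eq_zero fun h => h.1.not_ge hs
  refine ⟨fun t => ∫ s in (0 : ℝ)..t, b s,
    IsTest.of_support_subset ?_ isCompact_Icc (fun t ht => ?_) hI, hder⟩
  · refine contDiff_infty_iff_deriv.2 ⟨fun t => ?_, by rw [hder]; exact hb.contDiff⟩
    exact (hb.continuous.integral_hasStrictDerivAt 0 t).hasDerivAt.differentiableAt
  · by_contra hn
    refine ht ?_
    change ∫ s in (0 : ℝ)..t, b s = 0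
    rw [hB]
    rcases lt_or_ge t α with h | h
    · exact setIntegral_eq_zero_of_forall_eq_zero fun s hs =>
        hzero s fun hs' => (hs'.1.trans hs).not_gt h
    · have h' : β < t := by
        by_contra! h'
        exact hn ⟨h, h'⟩
      have := setIntegral_compl (measurableSet_Iic (a := t)) hint
      rw [h0, setIntegral_eq_zero_of_forall_eq_zero (t := (Set.Iic t)ᶜ)] at this
      · linarith
      · exact fun s hs => hzero s fun hs' => hs (hs'.2.trans h'.le)

/-- The fundamental lemma of du Bois-Reymond, for functions with mean zero. -/
lemma ae_eq_zero_of_integral_deriv_mul_eq_zero {l : ℝ} (hl : 0 < l) {m : ℝ → ℝ}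
    (hm : IntegrableOn m (Set.Ioo 0 l)) (h0 : ∫ t in Set.Ioo 0 l, m t = 0)
    (h : ∀ B, IsTest (Set.Ioo 0 l) B → ∫ t in Set.Ioo 0 l, deriv B t * m t = 0) :
    m =ᵐ[volume.restrict (Set.Ioo 0 l)] 0 := by
  obtain ⟨ρ, hρ, hρ1⟩ := exists_isTest_integral_eq_one hl
  have hi {φ : ℝ → ℝ} (hφ : IsTest (Set.Ioo 0 l) φ) : IntegrableOn φ (Set.Ioo 0 l) :=
    (hφ.continuous.integrable_of_hasCompactSupport hφ.compact).integrableOn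
  have hmul {φ : ℝ → ℝ} (hφ : IsTest (Set.Ioo 0 l) φ) :
      IntegrableOn (fun t => φ t * m t) (Set.Ioo 0 l) := by
    obtain ⟨C, hC⟩ := hφ.compact.exists_bound_of_continuous hφ.continuous
    exact Integrable.bdd_mul hm hφ.continuous.aestronglyMeasurable
      (Filter.Eventually.of_forall hC)
  set κ := ∫ t in Set.Ioo 0 l, ρ t * m t with hκ
  have hconst : IntegrableOn (fun _ => κ) (Set.Ioo 0 l) := by simp
  have key : (fun t => m t - κ) =ᵐ[volume.restrict (Set.Ioo 0 l)] 0 := by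
    refine ae_eq_zero_of_forall_isTest isOpen_Ioo (hm.sub hconst) fun b hb => ?_
    set β := ∫ t in Set.Ioo 0 l, b t with hβ
    -- Subtracting `β ρ` makes the mean zero, so `b - β ρ` is the derivative of a test function and
    -- `m` annihilates it.
    have hc := hb.add (hρ.const_smul (-β))
    obtain ⟨B, hB, hBc⟩ := hc.exists_deriv_eq (by
      simp only [Pi.add_apply, Pi.smul_apply, smul_eq_mul]
      rw [integral_add (hi hb) ((hi hρ).const_mul _), integral_const_mul, hρ1, ← hβ]
      ring)
    have := h B hB
    rw [hBc] at this
    simp only [Pi.add_apply, Pi.smul_apply, smul_eq_mul, add_mul, mul_assoc] at this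
    rw [integral_add (hmul hb) ((hmul hρ).const_mul _), integral_const_mul, ← hκ] at this
    simp_rw [mul_sub]
    rw [integral_sub (hmul hb) ((hi hb).mul_const _), integral_mul_const, ← hβ]
    linarith
  have hκ0 : κ = 0 := by
    have := integral_congr_ae key
    rw [integral_sub hm hconst, h0] at this
    simpa [hl.le, hl.ne'] using this
  filter_upwards [key] with t ht
  simpa [hκ0] using ht

/-- Rectangles form a π-system generating the product σ-algebra; the sets over which `f` integrates
to zero are closed under complement, as the total integral is zero, and under disjoint unions. -/
lemma ae_eq_zero_of_setIntegral_prod_eq_zero {X Y : Type*} [MeasurableSpace X]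
    [MeasurableSpace Y] {μ : Measure (X × Y)} {f : X × Y → ℝ} (hf : Integrable f μ)
    (h : ∀ S T, MeasurableSet S → MeasurableSet T → ∫ p in S ×ˢ T, f p ∂μ = 0) :
    f =ᵐ[μ] 0 := by
  have huniv : ∫ p, f p ∂μ = 0 := by
    simpa using h Set.univ Set.univ MeasurableSet.univ MeasurableSet.univ
  have key (s : Set (X × Y)) (hs : MeasurableSet s) : ∫ p in s, f p ∂μ = 0 := by
    induction s, hs using
      MeasurableSpace.induction_on_inter generateFrom_prod.symm isPiSystem_prod with
    | empty => simp
    | basic t ht =>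
      obtain ⟨S, hS, T, hT, rfl⟩ := ht
      exact h S T hS hT
    | compl t ht ih => rw [setIntegral_compl ht hf, ih, huniv, sub_zero]
    | iUnion t hd ht ih =>
      rw [integral_iUnion ht hd hf.integrableOn]
      simp [ih]
  exact hf.ae_eq_zero_of_forall_setIntegral_eq_zero fun s hs _ => key s hs

end NeumannConvex

/-! ### The Poincaré inequality in the vertical direction -/

namespace NeumannConvex

variable {d : ℕ} {Ω : Set (E d)} {l : ℝ}

lemma isFiniteMeasure_restrict_cyl (hΩ : IsBoundedConvexDomain Ω) (hl : 0 < l) :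
    IsFiniteMeasure ((volume : Measure (E (d + 1))).restrict (cyl Ω l)) :=
  ⟨by simpa using (isBoundedConvexDomain_cyl hΩ hl).bounded.measure_lt_top⟩

/-- A function on the cylinder with vanishing vertical derivative and vanishing vertical averages
is zero. -/
lemma eq_zero_of_integral_fderiv_vert_eq_zero (hΩ : IsBoundedConvexDomain Ω) (hl : 0 < l)
    {y : L2 (cyl Ω l) ℝ} (h0 : (lift Ω l .id).adjoint y = 0)
    (hy : ∀ Φ, IsTest (cyl Ω l) Φ → ∫ z in cyl Ω l, y z * fderiv ℝ Φ z (vert d) = 0) :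
    y = 0 := by
  have := isFiniteMeasure_restrict_cyl hΩ hl
  have hyi : IntegrableOn y (cyl Ω l) := (Lp.memLp y).integrable (by norm_num)
  have ind_le {X : Type} (S : Set X) (t : X) : |S.indicator (1 : X → ℝ) t| ≤ 1 := by
    by_cases h : t ∈ S <;> simp [h]
  -- The slice integral of `y` against `a` has mean zero by `h0`, and zero weak derivative by
  -- testing with products `a ⊗ B`; du Bois-Reymond makes it vanish.
  have step1 (a : E d → ℝ) (ha : IsTest Ω a) (T : Set ℝ) (hT : MeasurableSet T) :
      ∫ z in cyl Ω l, T.indicator 1 (height d z) * (y z * a (base d z)) = 0 := by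
    have hF : IntegrableOn (fun z => y z * a (base d z)) (cyl Ω l) :=
      (Lp.memLp y).integrable_mul (memLp_comp_base (ha.memLp _) l .id)
    have hm := ae_eq_zero_of_integral_deriv_mul_eq_zero hl (integrableOn_integral_slice hF) (by
      rw [← integral_cyl_eq_integral_slice hF, ← integral_adjoint_lift_mul y ha, h0]
      refine integral_eq_zero_of_ae ?_
      filter_upwards [Lp.coeFn_zero ℝ 2 (volume.restrict Ω)] with x hx
      rw [hx, Pi.zero_apply, zero_mul]) (fun B hB => by
      have hB' : IsTest (Set.Ioo 0 l) (deriv B) := hB.fderiv_apply (1 : ℝ)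
      rw [← integral_height_mul (hB'.integrableOn_height_mul hF),
        ← hy _ (ha.mul_base_height hB)]
      simp_rw [fderiv_mul_base_height ha.differentiable hB.differentiable]
      congr 1
      ext z
      simp
      ring)
    rw [integral_height_mul (integrableOn_height_mul hF (measurable_one.indicator hT)
      (ind_le T))]
    refine integral_eq_zero_of_ae ?_
    filter_upwards [hm] with t ht
    rw [ht, Pi.zero_apply, mul_zero]
  have hyp := (integrableOn_cyl_iff Ω l).1 hyi
  have step2 : (fun p => y (pt d p)) =ᵐ[(volume.restrict Ω).prod
      (volume.restrict (Set.Ioo 0 l))] 0 := by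
    refine ae_eq_zero_of_setIntegral_prod_eq_zero hyp fun S T hS hT => ?_
    have hG : Integrable (fun p : E d × ℝ => T.indicator 1 p.2 * y (pt d p))
        ((volume.restrict Ω).prod (volume.restrict (Set.Ioo 0 l))) :=
      hyp.bdd_mul ((measurable_one.indicator hT).comp measurable_snd).aestronglyMeasurable
        (Filter.Eventually.of_forall fun p => ind_le T p.2)
    -- With `T` fixed, the fundamental lemma on `Ω` replaces the test functions `a` by arbitrary
    -- measurable sets `S`.
    have hV := ae_eq_zero_of_forall_isTest hΩ.isOpen hG.integral_prod_left (fun a ha => by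
      obtain ⟨C, hC⟩ := ha.compact.exists_bound_of_continuous ha.continuous
      have hi : Integrable (fun p : E d × ℝ => a p.1 * (T.indicator 1 p.2 * y (pt d p)))
          ((volume.restrict Ω).prod (volume.restrict (Set.Ioo 0 l))) :=
        hG.bdd_mul (ha.continuous.comp continuous_fst).aestronglyMeasurable
          (Filter.Eventually.of_forall fun p => hC p.1)
      have := step1 a ha T hT
      rw [integral_cyl] at this
      simp only [base_pt, height_pt] at this
      simp_rw [← integral_const_mul]
      refine (integral_prod _ hi).symm.trans (Eq.trans ?_ this)
      congr 1
      ext p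
      ring)
    have hi : Integrable (fun p : E d × ℝ => S.indicator 1 p.1 * (T.indicator 1 p.2 * y (pt d p)))
        ((volume.restrict Ω).prod (volume.restrict (Set.Ioo 0 l))) :=
      hG.bdd_mul ((measurable_one.indicator hS).comp measurable_fst).aestronglyMeasurable
        (Filter.Eventually.of_forall fun p => ind_le S p.1)
    calc _ = ∫ p, S.indicator 1 p.1 * (T.indicator 1 p.2 * y (pt d p))
          ∂((volume.restrict Ω).prod (volume.restrict (Set.Ioo 0 l))) := by
          rw [← integral_indicator (hS.prod hT)]
          congr 1
          ext p
          by_cases h1 : p.1 ∈ S <;> by_cases h2 : p.2 ∈ T <;> simp [h1, h2]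
      _ = 0 := by
          rw [integral_prod _ hi]
          refine integral_eq_zero_of_ae ?_
          filter_upwards [hV] with x hx
          rw [integral_const_mul, hx, Pi.zero_apply, mul_zero]
  have step3 := (pt d).measurableEmbedding.ae_map_iff (p := fun z => y z = 0) |>.2 step2
  rw [(measurePreserving_pt_cyl Ω l).map_eq] at step3
  exact (Lp.eq_zero_iff_ae_eq_zero).2 step3

/-- The functions of `L²` of the cylinder that are vertical derivatives of test functions. -/
noncomputable def verticalDerivatives (Ω : Set (E d)) (l : ℝ) : Submodule ℝ (L2 (cyl Ω l) ℝ) where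
  carrier := {f | ∃ Φ, IsTest (cyl Ω l) Φ ∧
    f =ᵐ[volume.restrict (cyl Ω l)] fun z => fderiv ℝ Φ z (vert d)}
  zero_mem' := by
    refine ⟨0, isTest_zero, ?_⟩
    filter_upwards [Lp.coeFn_zero ℝ 2 (volume.restrict (cyl Ω l))] with z hz
    simpa using hz
  add_mem' := by
    rintro f g ⟨Φ, h, hf⟩ ⟨Ψ, h', hg⟩
    refine ⟨Φ + Ψ, h.add h', ?_⟩
    filter_upwards [Lp.coeFn_add f g, hf, hg] with z h1 h2 h3
    rw [h1, Pi.add_apply, h2, h3, fderiv_add (h.differentiable z) (h'.differentiable z)]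
    rfl
  smul_mem' := by
    rintro c f ⟨Φ, h, hf⟩
    refine ⟨c • Φ, h.const_smul c, ?_⟩
    filter_upwards [Lp.coeFn_smul c f, hf] with z h1 h2
    rw [h1, Pi.smul_apply, h2, fderiv_const_smul (h.differentiable z)]
    rfl

lemma IsTest.toLp_mem_verticalDerivatives {Φ : E (d + 1) → ℝ} (h : IsTest (cyl Ω l) Φ) :
    ((h.fderiv_apply (vert d)).memLp (volume.restrict (cyl Ω l))).toLp ∈ verticalDerivatives Ω l :=
  ⟨Φ, h, MemLp.coeFn_toLp _⟩

lemma inner_lift_of_mem_verticalDerivatives (u : L2 Ω ℝ) {f : L2 (cyl Ω l) ℝ}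
    (hf : f ∈ verticalDerivatives Ω l) : inner ℝ (lift Ω l .id u) f = 0 := by
  obtain ⟨Φ, h, hf⟩ := hf
  have hu : MemLp (fun z => u (base d z)) 2 (volume.restrict (cyl Ω l)) :=
    memLp_comp_base (Lp.memLp u) l .id
  have hint : IntegrableOn (fun z => u (base d z) * fderiv ℝ Φ z (vert d)) (cyl Ω l) :=
    hu.integrable_mul ((h.fderiv_apply _).memLp _)
  have : ∫ z in cyl Ω l, u (base d z) * fderiv ℝ Φ z (vert d) = 0 := by
    rw [integral_cyl, integral_prod _ ((integrableOn_cyl_iff Ω l).1 hint)]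
    simp [integral_const_mul, integral_fderiv_vert h]
  rw [← integral_mul_eq_inner, ← this]
  refine integral_congr_ae ?_
  filter_upwards [hf, coeFn_lift (l := l) .id u] with z h1 h2
  rw [h1, h2]
  rfl

/-- By double orthogonality: a `y` orthogonal to all vertical derivatives equals its vertical
average, hence is a lift, and `h0` says that `v` is orthogonal to lifts. -/
lemma mem_closure_verticalDerivatives (hΩ : IsBoundedConvexDomain Ω) (hl : 0 < l)
    {v : L2 (cyl Ω l) ℝ} (h0 : (lift Ω l .id).adjoint v = 0) :
    v ∈ closure (verticalDerivatives Ω l : Set (L2 (cyl Ω l) ℝ)) := by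
  rw [← Submodule.topologicalClosure_coe, SetLike.mem_coe,
    ← Submodule.orthogonal_orthogonal_eq_closure, Submodule.mem_orthogonal]
  intro y hy
  rw [Submodule.mem_orthogonal'] at hy
  set w := l⁻¹ • (lift Ω l .id).adjoint y with hw
  have hyw : y - lift Ω l .id w = 0 := by
    refine eq_zero_of_integral_fderiv_vert_eq_zero hΩ hl ?_ fun Φ hΦ => ?_
    · rw [map_sub, adjoint_lift_lift hl.le, hw, smul_smul, mul_inv_cancel₀ hl.ne', one_smul,
        sub_self]
    · rw [integral_mul_eq_inner_toLp _ ((hΦ.fderiv_apply _).memLp _), inner_sub_left,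
        hy _ hΦ.toLp_mem_verticalDerivatives,
        inner_lift_of_mem_verticalDerivatives _ hΦ.toLp_mem_verticalDerivatives, sub_zero]
  rw [sub_eq_zero.1 hyw, ← ContinuousLinearMap.adjoint_inner_right, h0, inner_zero_right]

lemma norm_sq_eq_integral {X : Type*} [MeasurableSpace X] {μ : Measure X} {f : X → ℝ}
    (hf : MemLp f 2 μ) : ‖hf.toLp‖ ^ 2 = ∫ x, f x * f x ∂μ := by
  rw [← real_inner_self_eq_norm_sq, ← integral_mul_eq_inner_toLp]
  refine integral_congr_ae ?_
  filter_upwards [hf.coeFn_toLp] with x hx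
  rw [hx]

/-- The Friedrichs inequality in the vertical direction. -/
lemma IsTest.norm_le_vertical (hmeas : MeasurableSet (cyl Ω l)) (hl : 0 < l) {Φ : E (d + 1) → ℝ} (hΦ : IsTest (cyl Ω l) Φ) :
    ‖(hΦ.memLp (volume.restrict (cyl Ω l))).toLp‖ ≤
      2 * l * ‖((hΦ.fderiv_apply (vert d)).memLp (volume.restrict (cyl Ω l))).toLp‖ := by
  have hD := hΦ.fderiv_apply (vert d)
  have hτΦ : IsTest (cyl Ω l) (fun z => height d z * Φ z) :=
    ⟨(height d).contDiff.mul hΦ.contDiff, hΦ.compact.mul_left,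
      (tsupport_mul_subset_right).trans hΦ.subset⟩
  have hτD : IsTest (cyl Ω l) (fun z => height d z * fderiv ℝ Φ z (vert d)) :=
    ⟨(height d).contDiff.mul hD.contDiff, hD.compact.mul_left,
      (tsupport_mul_subset_right).trans hD.subset⟩
  have hder (z : E (d + 1)) : fderiv ℝ (fun z => height d z * Φ z) z (vert d) =
      Φ z + height d z * fderiv ℝ Φ z (vert d) := by
    have h3 : HasFDerivAt (fun z => height d z * Φ z) _ z :=
      (height d).hasFDerivAt.mul (hΦ.differentiable z).hasFDerivAt
    rw [h3.fderiv]
    simp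
    ring
  have hint {f g : E (d + 1) → ℝ} (hf : IsTest (cyl Ω l) f) (hg : IsTest (cyl Ω l) g) :
      Integrable (fun z => f z * g z) :=
    (hf.continuous.mul hg.continuous).integrable_of_hasCompactSupport hf.compact.mul_right
  -- Integration by parts of `τ Φ` against `∂Φ`, with `τ` the height. Since `0 < τ < l` on the
  -- cylinder, this is the source of the constant `2 l`.
  have hparts : ∫ z, Φ z * Φ z = -2 * ∫ z, Φ z * (height d z * fderiv ℝ Φ z (vert d)) := by
    have := integral_mul_fderiv_eq_neg_fderiv_mul_of_integrable (μ := volume) (v := vert d)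
      (hint (hτΦ.fderiv_apply (vert d)) hΦ) (hint hτΦ hD) (hint hτΦ hΦ)
      (fun x _ => hτΦ.differentiable x) (fun x _ => hΦ.differentiable x)
    simp_rw [hder, add_mul] at this
    rw [integral_add (hint hΦ hΦ) (hint hτD hΦ)] at this
    have e1 : ∫ z, height d z * Φ z * fderiv ℝ Φ z (vert d) =
        ∫ z, Φ z * (height d z * fderiv ℝ Φ z (vert d)) := by
      congr 1; ext z; ring
    have e2 : ∫ z, height d z * fderiv ℝ Φ z (vert d) * Φ z =
        ∫ z, Φ z * (height d z * fderiv ℝ Φ z (vert d)) := by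
      congr 1; ext z; ring
    rw [e1, e2] at this
    linarith
  have hset {f : E (d + 1) → ℝ} : ∫ z in cyl Ω l, Φ z * f z = ∫ z, Φ z * f z :=
    setIntegral_eq_integral_of_forall_compl_eq_zero fun z hz => by rw [hΦ.eq_zero hz, zero_mul]
  set ν := volume.restrict (cyl Ω l) with hν
  have hsq : ‖(hΦ.memLp ν).toLp‖ ^ 2 =
      -2 * inner ℝ (hΦ.memLp ν).toLp (hτD.memLp ν).toLp := by
    rw [norm_sq_eq_integral, hset, hparts, ← hset, ← integral_mul_eq_inner_toLp]
    congr 1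
    refine integral_congr_ae ?_
    filter_upwards [(hΦ.memLp ν).coeFn_toLp] with z hz
    rw [hz]
  have hle : ‖(hτD.memLp ν).toLp‖ ≤ l * ‖(hD.memLp ν).toLp‖ := by
    refine Lp.norm_le_mul_norm_of_ae_le_mul ?_
    filter_upwards [(hτD.memLp ν).coeFn_toLp, (hD.memLp ν).coeFn_toLp,
      ae_restrict_mem₀ hmeas.nullMeasurableSet] with z h1 h2 h3
    rw [h1, h2, norm_mul, Real.norm_eq_abs, abs_of_pos h3.2.1]
    exact mul_le_mul_of_nonneg_right h3.2.2.le (norm_nonneg _)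
  have hcs := abs_real_inner_le_norm (hΦ.memLp ν).toLp (hτD.memLp ν).toLp
  have hb : ‖(hΦ.memLp ν).toLp‖ ^ 2 ≤
      2 * l * ‖(hD.memLp ν).toLp‖ * ‖(hΦ.memLp ν).toLp‖ := by
    rw [hsq]
    have h1 := neg_le_abs (inner ℝ (hΦ.memLp ν).toLp (hτD.memLp ν).toLp)
    have h2 := mul_le_mul_of_nonneg_left hle (norm_nonneg (hΦ.memLp ν).toLp)
    linarith
  rcases (norm_nonneg (hΦ.memLp ν).toLp).eq_or_lt with h0 | h0
  · rw [← h0]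
    positivity
  · exact le_of_mul_le_mul_right (by rwa [← pow_two]) h0

/-- Duality: `⟪v, ∂Φ⟫ = -⟪h, Φ • vert⟫` is at most `‖h‖ ‖Φ‖ ≤ 2 l ‖h‖ ‖∂Φ‖`. The bound extends to
the closure of the vertical derivatives, which contains `v` itself. -/
lemma norm_le_of_adjoint_lift_eq_zero (hΩ : IsBoundedConvexDomain Ω) (hl : 0 < l)
    {v : L2 (cyl Ω l) ℝ} {h : L2 (cyl Ω l) (E (d + 1))} (hv : HasWeakGradient v h)
    (h0 : (lift Ω l .id).adjoint v = 0) : ‖v‖ ≤ 2 * l * ‖h‖ := by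
  have key (F : L2 (cyl Ω l) ℝ) (hF : F ∈ verticalDerivatives Ω l) :
      inner ℝ v F ≤ 2 * l * ‖h‖ * ‖F‖ := by
    obtain ⟨Φ, hΦ, hF⟩ := hF
    have hF' : F = ((hΦ.fderiv_apply (vert d)).memLp (volume.restrict (cyl Ω l))).toLp :=
      Lp.ext (hF.trans (MemLp.coeFn_toLp _).symm)
    subst hF'
    have hs := hΦ.memLp_smul (vert d) (volume.restrict (cyl Ω l))
    have hn : ‖hs.toLp‖ = ‖(hΦ.memLp (volume.restrict (cyl Ω l))).toLp‖ := by
      rw [Lp.norm_toLp, Lp.norm_toLp]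
      congr 1
      refine eLpNorm_congr_norm_ae (Filter.Eventually.of_forall fun z => ?_)
      simp [norm_smul, norm_vert]
    have hw := hv Φ hΦ.contDiff hΦ.compact hΦ.subset (vert d)
    rw [integral_mul_eq_inner_toLp _ ((hΦ.fderiv_apply (vert d)).memLp _)] at hw
    have : ∫ z in cyl Ω l, inner ℝ (h z) (vert d) * Φ z = inner ℝ h hs.toLp := by
      rw [← integral_inner_eq_inner_toLp]
      simp [real_inner_smul_right, mul_comm]
    rw [this] at hw
    rw [hw]
    calc -inner ℝ h hs.toLp ≤ ‖h‖ * ‖hs.toLp‖ :=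
          (neg_le_abs _).trans (abs_real_inner_le_norm _ _)
      _ ≤ ‖h‖ * (2 * l * ‖((hΦ.fderiv_apply (vert d)).memLp (volume.restrict (cyl Ω l))).toLp‖) := by
          rw [hn]
          exact mul_le_mul_of_nonneg_left (hΦ.norm_le_vertical (isBoundedConvexDomain_cyl hΩ hl).isOpen.measurableSet hl) (norm_nonneg _)
      _ = _ := by ring
  have hcl : IsClosed {F : L2 (cyl Ω l) ℝ | inner ℝ v F ≤ 2 * l * ‖h‖ * ‖F‖} :=
    isClosed_le (by fun_prop) (by fun_prop)
  have := hcl.closure_subset_iff.2 key (mem_closure_verticalDerivatives hΩ hl h0)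
  rw [Set.mem_ofPred_eq, real_inner_self_eq_norm_sq] at this
  rcases (norm_nonneg v).eq_or_lt with hv0 | hv0
  · rw [← hv0]
    positivity
  · exact le_of_mul_le_mul_right (by linarith) hv0

end NeumannConvex

/-! ### Neumann solutions and eigenvalues of thin cylinders -/

namespace NeumannConvex

variable {d : ℕ} {Ω : Set (E d)} {l ν μ : ℝ}

lemma isNeumannSolution_iff {u : L2 Ω ℝ} : IsNeumannSolution ν u ↔
    ∃ g : L2 Ω (E d), HasWeakGradient u g ∧ ∀ (v : L2 Ω ℝ) (h : L2 Ω (E d)),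
      HasWeakGradient v h → inner ℝ g h = ν * inner ℝ u v := by
  simp_rw [IsNeumannSolution, integral_mul_eq_inner, L2.inner_def]

lemma HasWeakGradient.sub {u v : L2 Ω ℝ} {g h : L2 Ω (E d)} (hu : HasWeakGradient u g)
    (hv : HasWeakGradient v h) : HasWeakGradient (u - v) (g - h) := by
  intro φ h1 h2 h3 e
  have hφ : IsTest Ω φ := ⟨h1, h2, h3⟩
  have hL (w : L2 Ω ℝ) : IntegrableOn (fun x => w x * fderiv ℝ φ x e) Ω :=
    (Lp.memLp w).integrable_mul ((hφ.fderiv_apply e).memLp _)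
  have hR (w : L2 Ω (E d)) : IntegrableOn (fun x => inner ℝ (w x) e * φ x) Ω :=
    ((Lp.memLp w).inner_const e).integrable_mul (hφ.memLp _)
  have e1 : ∫ x in Ω, (u - v : L2 Ω ℝ) x * fderiv ℝ φ x e =
      ∫ x in Ω, (u x * fderiv ℝ φ x e - v x * fderiv ℝ φ x e) := by
    refine integral_congr_ae ?_
    filter_upwards [Lp.coeFn_sub u v] with x hx
    rw [hx, Pi.sub_apply, sub_mul]
  have e2 : ∫ x in Ω, inner ℝ ((g - h : L2 Ω (E d)) x) e * φ x =
      ∫ x in Ω, (inner ℝ (g x) e * φ x - inner ℝ (h x) e * φ x) := by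
    refine integral_congr_ae ?_
    filter_upwards [Lp.coeFn_sub g h] with x hx
    rw [hx, Pi.sub_apply, inner_sub_left, sub_mul]
  rw [e1, e2, integral_sub (hL u) (hL v), integral_sub (hR g) (hR h), hu φ h1 h2 h3 e,
    hv φ h1 h2 h3 e]
  ring

lemma HasWeakGradient.const_smul {u : L2 Ω ℝ} {g : L2 Ω (E d)} (hu : HasWeakGradient u g)
    (c : ℝ) : HasWeakGradient (c • u) (c • g) := by
  intro φ h1 h2 h3 e
  have e1 : ∫ x in Ω, (c • u : L2 Ω ℝ) x * fderiv ℝ φ x e =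
      ∫ x in Ω, c * (u x * fderiv ℝ φ x e) := by
    refine integral_congr_ae ?_
    filter_upwards [Lp.coeFn_smul c u] with x hx
    rw [hx, Pi.smul_apply, smul_eq_mul, mul_assoc]
  have e2 : ∫ x in Ω, inner ℝ ((c • g : L2 Ω (E d)) x) e * φ x =
      ∫ x in Ω, c * (inner ℝ (g x) e * φ x) := by
    refine integral_congr_ae ?_
    filter_upwards [Lp.coeFn_smul c g] with x hx
    rw [hx, Pi.smul_apply, real_inner_smul_left, mul_assoc]
  rw [e1, e2, integral_const_mul, integral_const_mul, hu φ h1 h2 h3 e]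
  ring

/-- A test pair on the cylinder is moved to the base by the adjoints, which turn it into a function
and its weak gradient there. The converse transfer, `IsNeumannSolution.adjoint_lift`, exchanges the
two roles. -/
lemma IsNeumannSolution.lift {u : L2 Ω ℝ} (hu : IsNeumannSolution ν u) (l : ℝ) :
    IsNeumannSolution ν (lift Ω l .id u) := by
  obtain ⟨g, hg, H⟩ := isNeumannSolution_iff.1 hu
  refine isNeumannSolution_iff.2 ⟨_, hasWeakGradient_lift hg l, fun v h hv => ?_⟩
  rw [← ContinuousLinearMap.adjoint_inner_right, ← ContinuousLinearMap.adjoint_inner_right]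
  exact H _ _ (hasWeakGradient_adjoint_lift hv)

lemma IsNeumannSolution.const_smul {u : L2 Ω ℝ} (hu : IsNeumannSolution ν u) (c : ℝ) :
    IsNeumannSolution ν (c • u) := by
  obtain ⟨g, hg, H⟩ := isNeumannSolution_iff.1 hu
  refine isNeumannSolution_iff.2 ⟨_, hg.const_smul c, fun v h hv => ?_⟩
  rw [real_inner_smul_left, real_inner_smul_left, H v h hv]
  ring

lemma IsNeumannSolution.adjoint_lift {w : L2 (cyl Ω l) ℝ} (hw : IsNeumannSolution ν w) :
    IsNeumannSolution ν ((NeumannConvex.lift Ω l .id).adjoint w) := by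
  obtain ⟨g, hg, H⟩ := isNeumannSolution_iff.1 hw
  refine isNeumannSolution_iff.2 ⟨_, hasWeakGradient_adjoint_lift hg, fun v h hv => ?_⟩
  rw [ContinuousLinearMap.adjoint_inner_left, ContinuousLinearMap.adjoint_inner_left]
  exact H _ _ (hasWeakGradient_lift hv l)

section Average

variable {F G : Type} [NormedAddCommGroup F] [InnerProductSpace ℝ F] [CompleteSpace F]
  [NormedAddCommGroup G] [InnerProductSpace ℝ G] [CompleteSpace G]

/-- The part of `u` orthogonal to the functions lifted from the base. -/
noncomputable def vertPart (Ω : Set (E d)) (l : ℝ) (L : F →ₗᵢ[ℝ] G) (u : L2 (cyl Ω l) G) :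
    L2 (cyl Ω l) G :=
  u - lift Ω l L (l⁻¹ • (lift Ω l L).adjoint u)

lemma adjoint_lift_vertPart (hl : 0 < l) (L : F →ₗᵢ[ℝ] G) (u : L2 (cyl Ω l) G) :
    (lift Ω l L).adjoint (vertPart Ω l L u) = 0 := by
  rw [vertPart, map_sub, adjoint_lift_lift hl.le, smul_smul, mul_inv_cancel₀ hl.ne', one_smul,
    sub_self]

/-- `vertPart` is an orthogonal projection. Testing the equation with the vertical part therefore
leaves only the norms of the vertical parts. -/
lemma inner_vertPart (hl : 0 < l) (L : F →ₗᵢ[ℝ] G) (u : L2 (cyl Ω l) G) :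
    inner ℝ u (vertPart Ω l L u) = ‖vertPart Ω l L u‖ ^ 2 := by
  rw [← real_inner_self_eq_norm_sq]
  conv_rhs => rw [vertPart, inner_sub_left]
  rw [← vertPart, ← ContinuousLinearMap.adjoint_inner_right, adjoint_lift_vertPart hl,
    inner_zero_right, sub_zero]

end Average

/-- In a cylinder of small height, the solutions do not depend on the height. -/
lemma IsNeumannSolution.eq_lift (hΩ : IsBoundedConvexDomain Ω) (hl : 0 < l)
    (hν : 4 * l ^ 2 * ν < 1) {w : L2 (cyl Ω l) ℝ} (hw : IsNeumannSolution ν w) :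
    w = NeumannConvex.lift Ω l .id (l⁻¹ • (NeumannConvex.lift Ω l .id).adjoint w) := by
  obtain ⟨g, hg, H⟩ := isNeumannSolution_iff.1 hw
  have hv : HasWeakGradient (vertPart Ω l .id w) (vertPart Ω l (incl d) g) :=
    hg.sub (hasWeakGradient_lift ((hasWeakGradient_adjoint_lift hg).const_smul _) l)
  have h1 := H _ _ hv
  rw [inner_vertPart hl, inner_vertPart hl] at h1
  have h2 := norm_le_of_adjoint_lift_eq_zero hΩ hl hv (adjoint_lift_vertPart hl _ _)
  have h3 := pow_le_pow_left₀ (norm_nonneg _) h2 2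
  -- Squaring the Poincaré constant `2 l` gives `4 l²`, and the equation replaces the squared
  -- gradient norm by `ν` times the squared norm.
  have h4 : (1 - 4 * l ^ 2 * ν) * ‖vertPart Ω l .id w‖ ^ 2 ≤ 0 := by
    rw [mul_pow, h1] at h3
    linarith
  have h5 : ‖vertPart Ω l .id w‖ ^ 2 = 0 :=
    le_antisymm (nonpos_of_mul_nonpos_right h4 (by linarith)) (by positivity)
  exact sub_eq_zero.1 (norm_eq_zero.1 (pow_eq_zero_iff two_ne_zero |>.1 h5))

/-- The generating sets already correspond, parameter by parameter, under `lift`. -/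
lemma neumannSpan_cyl (hΩ : IsBoundedConvexDomain Ω) (hl : 0 < l) {S : Set ℝ}
    (hS : ∀ ν ∈ S, 4 * l ^ 2 * ν < 1) :
    neumannSpan (cyl Ω l) S = (neumannSpan Ω S).map (lift Ω l .id).toLinearMap := by
  rw [neumannSpan, neumannSpan, Submodule.map_span]
  congr 1
  ext w
  constructor
  · rintro ⟨ν, hν, hw⟩
    exact ⟨_, ⟨ν, hν, hw.adjoint_lift.const_smul l⁻¹⟩, (hw.eq_lift hΩ hl (hS ν hν)).symm⟩
  · rintro ⟨u, ⟨ν, hν, hu⟩, rfl⟩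
    exact ⟨ν, hν, hu.lift l⟩

lemma rank_neumannSpan_cyl (hΩ : IsBoundedConvexDomain Ω) (hl : 0 < l) {S : Set ℝ}
    (hS : ∀ ν ∈ S, 4 * l ^ 2 * ν < 1) :
    Module.rank ℝ (neumannSpan (cyl Ω l) S) = Module.rank ℝ (neumannSpan Ω S) := by
  rw [neumannSpan_cyl hΩ hl hS]
  exact (Submodule.equivMapOfInjective (lift Ω l .id).toLinearMap (lift_injective hl .id)
    (neumannSpan Ω S)).rank_eq.symm

lemma IsNeumannEigenvalue.cyl (hΩ : IsBoundedConvexDomain Ω) (hl : 0 < l)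
    (hμ : 4 * l ^ 2 * μ < 1) {k : ℕ} (h : IsNeumannEigenvalue Ω k μ) :
    IsNeumannEigenvalue (cyl Ω l) k μ := by
  have hle (ν : ℝ) (hν : ν ≤ μ) : 4 * l ^ 2 * ν < 1 :=
    (mul_le_mul_of_nonneg_left hν (by positivity)).trans_lt hμ
  rw [IsNeumannEigenvalue, rank_neumannSpan_cyl hΩ hl (S := Set.Iio μ) fun ν hν => hle ν (le_of_lt hν),
    rank_neumannSpan_cyl hΩ hl (S := Set.Iic μ) hle]
  exact h

lemma exists_pos_mul_sq_mul_lt (μ : ℝ) : ∃ l : ℝ, 0 < l ∧ 4 * l ^ 2 * μ < 1 := by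
  have h : 0 < 1 + |μ| := by positivity
  -- With this height, `4 l² μ = μ / (1 + |μ|)²`, which is below `1`.
  refine ⟨(2 * (1 + |μ|))⁻¹, by positivity, ?_⟩
  have : 4 * ((2 * (1 + |μ|))⁻¹) ^ 2 * μ = μ / (1 + |μ|) ^ 2 := by
    field_simp
    norm_num
  rw [this, div_lt_one (by positivity)]
  nlinarith [le_abs_self μ, abs_nonneg μ]

end NeumannConvex

theorem theorem3p2 (k d : ℕ) (hk : 1 ≤ k) (hd : 1 ≤ d) :
    NeumannConvex.optConst k d ≥ NeumannConvex.optConst k (d + 1) := by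
  refine sInf_le_sInf ?_
  rintro r ⟨Ω₁, Ω₂, μ₁, μ₂, h₁, h₂, hsub, hμ₁, hμ₂, rfl⟩
  -- Both cylinders need the same height to remain nested, so it is chosen for the larger
  -- eigenvalue.
  obtain ⟨l, hl, hlt⟩ := NeumannConvex.exists_pos_mul_sq_mul_lt (max μ₁ μ₂)
  have hle (ν : ℝ) (hν : ν ≤ max μ₁ μ₂) : 4 * l ^ 2 * ν < 1 :=
    (mul_le_mul_of_nonneg_left hν (by positivity)).trans_lt hlt
  exact ⟨NeumannConvex.cyl Ω₁ l, NeumannConvex.cyl Ω₂ l, μ₁, μ₂,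
    NeumannConvex.isBoundedConvexDomain_cyl h₁ hl, NeumannConvex.isBoundedConvexDomain_cyl h₂ hl,
    NeumannConvex.cyl_mono hsub l, hμ₁.cyl h₁ hl (hle _ (le_max_left _ _)),
    hμ₂.cyl h₂ hl (hle _ (le_max_right _ _)), rfl⟩
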